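/- For $x\in(0,1]$ let $\zeta(s,x)$ be the Hurwitz zeta function, i.e. the meromorphic continuation to $\mathbb{C}$ of $\sum_{n\ge 0}(n+x)^{-s}$ ($\operatorname{Re} s>1$), and let the generalised Stieltjes constants $\gamma_n(x)$ be defined by the Laurent expansion $$\zeta(s,x)=\frac{1}{s-1}+\sum_{n=0}^{\infty}\frac{(-1)^n}{n!}\,\gamma_n(x)\,(s-1)^n$$ about $s=1$. Let $\gamma$ be Euler's constant and $\zeta'$ the derivative of the Riemann zeta function. **Theorem.** For every real $x$ with $0<x<1$ the series below converges absolutely and $$\gamma_1(1-x)-\gamma_1(x)=-\frac{\gamma+\log(2\pi x)}{x}+\pi\,[\gamma+\log(2\pi)]\cot(\pi x)+2\pi\sum_{n=0}^{\infty}\frac{(-1)^{n+1}\,\zeta'(-2n-1)}{(2n+1)!}\,(2\pi x)^{2n+1}.$$ -/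

import Mathlib

noncomputable section

/-- The regular part at `s = 1` of the Hurwitz zeta function `ζ(s, x) = ∑ 1 / (n + x) ^ s`, where
`0 < x ≤ 1`: the function `s ↦ ζ(s, x) - 1 / (s - 1)` for `s ≠ 1`, with the removable singularity
at `s = 1` filled in by the limit. (Mathlib's `HurwitzZeta.hurwitzZeta` is periodic in `x`; it is
the analytic continuation of the above series for `x` in this range.) -/
def hurwitzRegularPart (x : ℝ) : ℂ → ℂ :=
  Function.update (fun s : ℂ ↦ HurwitzZeta.hurwitzZeta (x : UnitAddCircle) s - 1 / (s - 1)) 1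
    (Filter.limUnder (nhdsWithin 1 {1}ᶜ)
      (fun s : ℂ ↦ HurwitzZeta.hurwitzZeta (x : UnitAddCircle) s - 1 / (s - 1)))

/-- The generalised Stieltjes constant `γ_n(x)`, for `0 < x ≤ 1`, normalised by the Laurent
expansion `ζ(s, x) = 1 / (s - 1) + ∑ (-1) ^ n / n! * γ_n(x) * (s - 1) ^ n` about `s = 1`
(see `hasSum_stieltjesConst`). -/
def stieltjesConst (n : ℕ) (x : ℝ) : ℂ :=
  (-1) ^ n * iteratedDeriv n (hurwitzRegularPart x) 1

theorem differentiable_hurwitzRegularPart (x : ℝ) : Differentiable ℂ (hurwitzRegularPart x) := by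
  have h : DifferentiableOn ℂ (hurwitzRegularPart x) Set.univ := by
    refine Complex.differentiableOn_update_limUnder_of_isLittleO (c := 1) Filter.univ_mem ?_ ?_
    · intro s hs
      have hs1 : s ≠ 1 := by simpa using hs
      have hd : DifferentiableAt ℂ (fun s : ℂ ↦ 1 / (s - 1)) s :=
        (differentiableAt_const _).div (by fun_prop) (sub_ne_zero.2 hs1)
      have hz := HurwitzZeta.differentiableAt_hurwitzZeta (x : UnitAddCircle) hs1
      exact (hz.fun_sub hd).differentiableWithinAt
    · have hne : ∀ᶠ s : ℂ in nhdsWithin 1 {1}ᶜ, s ≠ 1 := self_mem_nhdsWithin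
      refine (Asymptotics.isLittleO_iff_tendsto' ?_).2 ?_
      · filter_upwards [hne] with s hs h0
        exact absurd h0 (inv_ne_zero (sub_ne_zero.2 hs))
      · have h1 := HurwitzZeta.hurwitzZeta_residue_one (x : UnitAddCircle)
        have h2 : Filter.Tendsto (fun s : ℂ ↦ (s - 1)
            * (HurwitzZeta.hurwitzZeta (x : UnitAddCircle) 1 - 1 / ((1 : ℂ) - 1)))
            (nhdsWithin 1 {1}ᶜ) (nhds 0) := by
          refine Filter.Tendsto.mono_left ?_ nhdsWithin_le_nhds
          refine Continuous.tendsto' (by fun_prop) _ _ (by simp)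
        have h3 := (h1.sub_const 1).sub h2
        rw [show (1 : ℂ) - 1 - 0 = 0 by ring] at h3
        refine h3.congr' ?_
        filter_upwards [hne] with s hs
        have := sub_ne_zero.2 hs
        generalize HurwitzZeta.hurwitzZeta (x : UnitAddCircle) 1 - 1 / ((1 : ℂ) - 1) = c
        field_simp
  exact differentiableOn_univ.1 h

/-- The Laurent expansion that characterises the constants `γ_n(x)`. -/
theorem hasSum_stieltjesConst (x : ℝ) {s : ℂ} (hs : s ≠ 1) :
    HasSum (fun n : ℕ ↦ (-1) ^ n / (n.factorial : ℂ) * stieltjesConst n x * (s - 1) ^ n)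
      (HurwitzZeta.hurwitzZeta (x : UnitAddCircle) s - 1 / (s - 1)) := by
  have h := Complex.hasSum_taylorSeries_of_entire (differentiable_hurwitzRegularPart x) 1 s
  have e : hurwitzRegularPart x s
      = HurwitzZeta.hurwitzZeta (x : UnitAddCircle) s - 1 / (s - 1) := by
    simp [hurwitzRegularPart, hs]
  rw [e] at h
  refine Eq.subst (motive := fun f : ℕ → ℂ ↦ HasSum f _) (funext fun n ↦ ?_) h
  have h1 : ((-1 : ℂ) ^ n) * (-1) ^ n = 1 := by rw [← mul_pow]; simp
  simp only [stieltjesConst, smul_eq_mul]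
  linear_combination
    -((n.factorial : ℂ)⁻¹ * iteratedDeriv n (hurwitzRegularPart x) 1 * (s - 1) ^ n) * h1

end

/-! For Re s > 1, ζ(s,1-x) - ζ(s,x) is -x^(-s) plus the sum over N ≥ 1 of (N-x)^(-s) - (N+x)^(-s).
The binomial series in x/N keeps only odd powers, and summing over N first gives a series in
x^(2m+1) ζ(s+2m+1) (`exists_hasSum_of_odd_zeta`). It converges uniformly near s = 1, so the identity
theorem carries the formula there and it may be differentiated termwise: this produces H_{2m+1}
ζ(2m+2) + ζ'(2m+2). The differentiated functional equation (`deriv_riemannZeta_one_sub_two_mul`)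
trades this for ζ'(-2m-1) and (γ + log 2π) ζ(2m+2); the latter terms sum to a cotangent
(`hasSum_two_mul_zeta_even`). -/

open Complex Filter Topology

/-! ### Binomial series and its odd part -/

/-- The coefficient `s (s + 1) ⋯ (s + k - 1) / k!` of `z ^ k` in `(1 - z) ^ (-s)`. -/
noncomputable def risingCoeff (s : ℂ) (k : ℕ) : ℂ := ∏ j ∈ Finset.range k, (s + j) / (j + 1)

lemma risingCoeff_succ (s : ℂ) (k : ℕ) :
    risingCoeff s (k + 1) = risingCoeff s k * ((s + k) / (k + 1)) :=
  Finset.prod_range_succ _ _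

lemma risingCoeff_one (k : ℕ) : risingCoeff 1 k = 1 := by
  refine Finset.prod_eq_one fun j _ ↦ ?_
  rw [add_comm, div_self (Nat.cast_add_one_ne_zero j)]

lemma choose_eq_risingCoeff (s : ℂ) (k : ℕ) : Ring.choose (s + k - 1) k = risingCoeff s k := by
  have h : ∀ k : ℕ, (k.factorial : ℂ) * risingCoeff s k = (ascPochhammer ℂ k).eval s := by
    intro k
    induction k with
    | zero => simp [risingCoeff]
    | succ k ih =>
      have := Nat.cast_add_one_ne_zero (R := ℂ) k
      rw [risingCoeff_succ, ascPochhammer_succ_eval, ← ih, Nat.factorial_succ]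
      push_cast
      field_simp
  have h1 := Ring.factorial_nsmul_multichoose_eq_ascPochhammer s k
  rw [Polynomial.ascPochhammer_smeval_eq_eval, ← h, nsmul_eq_mul] at h1
  have h2 := mul_left_cancel₀ (Nat.cast_ne_zero.2 k.factorial_ne_zero) h1
  rw [← h2, Ring.choose]
  congr 1
  ring

/-- The factors are at most (j+2)/(j+1), and these telescope. -/
lemma norm_risingCoeff_le {s : ℂ} (hs : ‖s‖ ≤ 2) (k : ℕ) : ‖risingCoeff s k‖ ≤ k + 1 := by
  induction k with
  | zero => simp [risingCoeff]
  | succ k ih =>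
    have hk : (0 : ℝ) < k + 1 := by positivity
    have h1 : ‖(s + k) / ((k : ℂ) + 1)‖ ≤ (k + 2) / (k + 1) := by
      have e : ‖(k : ℂ) + 1‖ = k + 1 := by exact_mod_cast Complex.norm_natCast (k + 1)
      rw [norm_div, e]
      gcongr
      calc ‖s + k‖ ≤ ‖s‖ + ‖(k : ℂ)‖ := norm_add_le _ _
        _ ≤ k + 2 := by rw [Complex.norm_natCast]; linarith
    rw [risingCoeff_succ, norm_mul]
    calc _ ≤ ((k : ℝ) + 1) * ((k + 2) / (k + 1)) := by gcongr
      _ = _ := by push_cast; field_simp; ring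

lemma differentiable_risingCoeff (k : ℕ) : Differentiable ℂ (fun s ↦ risingCoeff s k) := by
  unfold risingCoeff
  fun_prop

lemma hasDerivAt_risingCoeff_one (k : ℕ) :
    HasDerivAt (fun s ↦ risingCoeff s k) (harmonic k : ℂ) 1 := by
  induction k with
  | zero => simpa [risingCoeff] using hasDerivAt_const (1 : ℂ) (1 : ℂ)
  | succ k ih =>
    have h1 : HasDerivAt (fun s : ℂ ↦ (s + k) / ((k : ℂ) + 1)) (1 / (k + 1)) 1 :=
      ((hasDerivAt_id (1 : ℂ)).add_const _).div_const _
    have h := ih.mul h1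
    simp only [risingCoeff_one] at h
    have := Nat.cast_add_one_ne_zero (R := ℂ) k
    have e : (fun s ↦ risingCoeff s (k + 1))
        = (fun s ↦ risingCoeff s k) * fun s : ℂ ↦ (s + k) / ((k : ℂ) + 1) :=
      funext fun s ↦ risingCoeff_succ s k
    rw [e]
    refine h.congr_deriv ?_
    rw [harmonic_succ, add_comm (1 : ℂ) k, div_self this]
    push_cast
    ring

lemma hasSum_risingCoeff_mul_pow (s : ℂ) {z : ℂ} (hz : ‖z‖ < 1) :
    HasSum (fun k ↦ risingCoeff s k * z ^ k) (1 / (1 - z) ^ s) := by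
  have h := (Complex.one_div_one_sub_cpow_hasFPowerSeriesOnBall_zero s).hasSum (y := z)
    (by simpa [Metric.mem_eball, edist_zero_right, ← ofReal_norm] using hz)
  simpa [FormalMultilinearSeries.ofScalars_apply_eq, choose_eq_risingCoeff, mul_comm] using h

lemma hasSum_odd_risingCoeff_mul_pow (s : ℂ) {z : ℂ} (hz : ‖z‖ < 1) :
    HasSum (fun m : ℕ ↦ 2 * risingCoeff s (2 * m + 1) * z ^ (2 * m + 1))
      (1 / (1 - z) ^ s - 1 / (1 + z) ^ s) := by
  have h := (hasSum_risingCoeff_mul_pow s hz).sub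
    (hasSum_risingCoeff_mul_pow s (z := -z) (by rwa [norm_neg]))
  rw [sub_neg_eq_add] at h
  have hi : Function.Injective (fun m : ℕ ↦ 2 * m + 1) := fun a b h ↦ by simpa using h
  rw [← hi.hasSum_iff] at h
  · refine h.congr_fun fun m ↦ ?_
    simp only [Function.comp_apply, Odd.neg_pow (odd_two_mul_add_one m)]
    ring
  · intro k hk
    have : Even k := by
      by_contra h
      obtain ⟨m, rfl⟩ := Nat.not_even_iff_odd.1 h
      exact hk ⟨m, rfl⟩
    simp [this.neg_pow]

lemma hasSum_one_div_sub_cpow_sub {x N : ℝ} (hx0 : 0 < x) (hx : x < N) (s : ℂ) :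
    HasSum (fun m : ℕ ↦ 2 * risingCoeff s (2 * m + 1) * (x : ℂ) ^ (2 * m + 1)
        * (1 / (N : ℂ) ^ (s + (2 * m + 1 : ℕ))))
      (1 / (N - x : ℂ) ^ s - 1 / (N + x : ℂ) ^ s) := by
  have hN : 0 < N := hx0.trans hx
  have hN' : (N : ℂ) ≠ 0 := ofReal_ne_zero.2 hN.ne'
  have hz : ‖(x / N : ℂ)‖ < 1 := by
    rw [← ofReal_div, norm_real, Real.norm_of_nonneg (by positivity)]
    exact (div_lt_one hN).2 hx
  have h := (hasSum_odd_risingCoeff_mul_pow s hz).mul_left (1 / (N : ℂ) ^ s)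
  have h1 : (N - x : ℂ) ^ s = (N : ℂ) ^ s * (1 - x / N) ^ s := by
    have := mul_cpow_ofReal_nonneg hN.le (b := 1 - x / N)
      (sub_nonneg.2 ((div_le_one hN).2 hx.le)) s
    push_cast at this
    rw [← this]
    congr 1
    field_simp
  have h2 : (N + x : ℂ) ^ s = (N : ℂ) ^ s * (1 + x / N) ^ s := by
    have := mul_cpow_ofReal_nonneg hN.le (b := 1 + x / N) (by positivity) s
    push_cast at this
    rw [← this]
    congr 1
    field_simp
  have e (a b : ℂ) : 1 / ((N : ℂ) ^ s * a) - 1 / ((N : ℂ) ^ s * b)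
      = 1 / (N : ℂ) ^ s * (1 / a - 1 / b) := by
    simp only [one_div, mul_inv]
    ring
  rw [h1, h2, e]
  refine h.congr_fun fun m ↦ ?_
  rw [cpow_add _ _ hN', cpow_natCast, div_pow]
  simp only [one_div, mul_inv]
  ring

/-! ### Expansion in odd powers of x -/

lemma summable_one_div_nat_add_one_rpow_three_half :
    Summable fun n : ℕ ↦ 1 / ((n : ℝ) + 1) ^ (3 / 2 : ℝ) := by
  have h := (summable_nat_add_iff 1).2
    (Real.summable_one_div_nat_rpow.2 (by norm_num : (1 : ℝ) < 3 / 2))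
  exact_mod_cast h

lemma norm_one_div_nat_add_one_cpow_le {s : ℂ} (hs : 3 / 2 ≤ s.re) (n : ℕ) :
    ‖1 / ((n : ℂ) + 1) ^ s‖ ≤ 1 / ((n : ℝ) + 1) ^ (3 / 2 : ℝ) := by
  have h := Complex.norm_natCast_cpow_of_pos n.succ_pos s
  push_cast at h
  rw [norm_div, norm_one, h]
  gcongr
  linarith [Nat.cast_nonneg (α := ℝ) n]

lemma norm_riemannZeta_le {s : ℂ} (hs : 3 / 2 ≤ s.re) :
    ‖riemannZeta s‖ ≤ ∑' n : ℕ, 1 / ((n : ℝ) + 1) ^ (3 / 2 : ℝ) := by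
  rw [zeta_eq_tsum_one_div_nat_add_one_cpow (by linarith)]
  exact tsum_of_norm_bounded summable_one_div_nat_add_one_rpow_three_half.hasSum
    (norm_one_div_nat_add_one_cpow_le hs)

lemma summable_odd_bound {x : ℝ} (hx0 : 0 < x) (hx1 : x < 1) :
    Summable fun m : ℕ ↦ 2 * (((2 * m + 1 : ℕ) : ℝ) + 1) * x ^ (2 * m + 1) := by
  have h1 : Summable fun k : ℕ ↦ (k : ℝ) ^ 1 * x ^ k :=
    summable_pow_mul_geometric_of_norm_lt_one 1 (by rwa [Real.norm_of_nonneg hx0.le])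
  have h2 := (h1.add (summable_geometric_of_lt_one hx0.le hx1)).mul_left 2
  have hi : Function.Injective (fun m : ℕ ↦ 2 * m + 1) := fun a b h ↦ by simpa using h
  refine (h2.comp_injective hi).congr fun m ↦ ?_
  simp only [Function.comp_apply]
  ring

lemma norm_odd_coeff_le {x : ℝ} (hx0 : 0 < x) {s : ℂ} (hs : ‖s‖ ≤ 2) (m : ℕ) :
    ‖2 * risingCoeff s (2 * m + 1) * (x : ℂ) ^ (2 * m + 1)‖
      ≤ 2 * (((2 * m + 1 : ℕ) : ℝ) + 1) * x ^ (2 * m + 1) := by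
  rw [norm_mul, norm_mul, norm_pow, norm_real, Real.norm_of_nonneg hx0.le, Complex.norm_ofNat]
  gcongr
  exact norm_risingCoeff_le hs _

/-- Both series are iterated sums of one absolutely convergent double series. Cancellation of the
even powers raises every exponent by at least 1, so s = 1 is allowed. -/
lemma exists_hasSum_of_odd_zeta {x : ℝ} (hx0 : 0 < x) (hx1 : x < 1) {s : ℂ} (hs : ‖s‖ ≤ 2)
    (hs' : 1 / 2 ≤ s.re) :
    ∃ F : ℂ, HasSum (fun n : ℕ ↦ 1 / ((n : ℂ) + 1 - x) ^ s - 1 / ((n : ℂ) + 1 + x) ^ s) F ∧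
      HasSum (fun m : ℕ ↦ 2 * risingCoeff s (2 * m + 1) * (x : ℂ) ^ (2 * m + 1)
        * riemannZeta (s + (2 * m + 1 : ℕ))) F := by
  have hre (m : ℕ) : 3 / 2 ≤ (s + (2 * m + 1 : ℕ)).re := by
    have : (0 : ℝ) ≤ m := m.cast_nonneg
    simp only [add_re, natCast_re]
    push_cast
    linarith
  let f : ℕ × ℕ → ℂ := fun p ↦ 2 * risingCoeff s (2 * p.1 + 1) * (x : ℂ) ^ (2 * p.1 + 1)
    * (1 / ((p.2 : ℂ) + 1) ^ (s + (2 * p.1 + 1 : ℕ)))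
  have hf : Summable f := by
    refine Summable.of_norm_bounded ((summable_odd_bound hx0 hx1).mul_of_nonneg
      summable_one_div_nat_add_one_rpow_three_half (fun m ↦ by positivity)
      (fun n ↦ by positivity)) fun p ↦ ?_
    rw [norm_mul]
    gcongr
    · exact norm_odd_coeff_le hx0 hs _
    · exact norm_one_div_nat_add_one_cpow_le (hre _) _
  refine ⟨∑' p, f p, ?_, ?_⟩
  · have h1 := (Equiv.prodComm ℕ ℕ).hasSum_iff.2 hf.hasSum
    refine h1.prod_fiberwise fun n ↦ ?_
    have hN : x < (n : ℝ) + 1 := by linarith [Nat.cast_nonneg (α := ℝ) n]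
    have h2 := hasSum_one_div_sub_cpow_sub hx0 hN s
    push_cast at h2
    refine h2.congr_fun fun m ↦ ?_
    simp [f]
  · refine hf.hasSum.prod_fiberwise fun m ↦ ?_
    have h : HasSum (fun n : ℕ ↦ 1 / ((n : ℂ) + 1) ^ (s + (2 * m + 1 : ℕ)))
        (riemannZeta (s + (2 * m + 1 : ℕ))) := by
      rw [zeta_eq_tsum_one_div_nat_add_one_cpow (by linarith [hre m])]
      exact (Summable.of_norm_bounded summable_one_div_nat_add_one_rpow_three_half
        (norm_one_div_nat_add_one_cpow_le (hre m))).hasSum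
    have h' := h.mul_left (2 * risingCoeff s (2 * m + 1) * (x : ℂ) ^ (2 * m + 1))
    exact h'.congr_fun fun n ↦ by simp only [f]

/-- At s = 1 the paired sum is the partial fraction expansion of the cotangent. -/
lemma hasSum_two_mul_zeta_even {x : ℝ} (hx0 : 0 < x) (hx1 : x < 1) :
    HasSum (fun m : ℕ ↦ 2 * (x : ℂ) ^ (2 * m + 1) * riemannZeta (1 + (2 * m + 1 : ℕ)))
      (1 / x - Real.pi * cot (Real.pi * x)) := by
  obtain ⟨F, h1, h2⟩ := exists_hasSum_of_odd_zeta hx0 hx1 (s := 1) (by norm_num) (by norm_num)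
  have hx : (x : ℂ) ∈ integerComplement := by
    rintro ⟨k, hk⟩
    have hk' : (k : ℝ) = x := by exact_mod_cast hk
    have h3 : (0 : ℤ) < k := by exact_mod_cast hk' ▸ hx0
    have h4 : k < (1 : ℤ) := by exact_mod_cast hk' ▸ hx1
    omega
  have hF : (1 / x - Real.pi * cot (Real.pi * x) : ℂ) = F := by
    rw [← neg_sub, cot_series_rep' hx, ← tsum_neg, ← h1.tsum_eq]
    congr 1
    ext n
    rw [cpow_one, cpow_one, ← neg_sub ((n : ℂ) + 1) x, add_comm (x : ℂ), div_neg]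
    ring
  rw [hF]
  simpa only [risingCoeff_one, mul_one] using h2

lemma hurwitzZeta_one_sub_sub {x : ℝ} (hx0 : 0 < x) (hx1 : x < 1) {s : ℂ} (hs : ‖s‖ ≤ 2)
    (hs' : 1 < s.re) :
    HurwitzZeta.hurwitzZeta ((1 - x : ℝ) : UnitAddCircle) s
        - HurwitzZeta.hurwitzZeta (x : UnitAddCircle) s
      = ∑' m : ℕ, 2 * risingCoeff s (2 * m + 1) * (x : ℂ) ^ (2 * m + 1)
        * riemannZeta (s + (2 * m + 1 : ℕ)) - 1 / (x : ℂ) ^ s := by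
  obtain ⟨F, h1, h2⟩ := exists_hasSum_of_odd_zeta hx0 hx1 hs (by linarith)
  have h3 := HurwitzZeta.hasSum_hurwitzZeta_of_one_lt_re
    (show 1 - x ∈ Set.Icc (0 : ℝ) 1 by constructor <;> linarith) hs'
  have h4 := HurwitzZeta.hasSum_hurwitzZeta_of_one_lt_re
    (show x ∈ Set.Icc (0 : ℝ) 1 from ⟨hx0.le, hx1.le⟩) hs'
  -- Splitting off the term x^(-s) aligns n+1+x with n+1-x.
  rw [← hasSum_nat_add_iff' 1] at h4
  simp only [Finset.range_one, Finset.sum_singleton, Nat.cast_zero, zero_add] at h4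
  have h5 := (h3.sub h4).unique (h1.congr_fun fun n ↦ ?_)
  · rw [h2.tsum_eq, ← h5]
    ring
  · push_cast
    rw [show (n : ℂ) + (1 - x) = n + 1 - x by ring]

/-! ### Differentiated functional equation -/

lemma deriv_riemannZeta_one_sub_two_mul (n : ℕ) :
    deriv riemannZeta (-2 * (n : ℂ) - 1) =
      (-1) ^ n * 2 * (2 * n + 1).factorial / (2 * Real.pi : ℂ) ^ (2 * n + 2) *
        ((harmonic (2 * n + 1) - Real.eulerMascheroniConstant - Real.log (2 * Real.pi))
          * riemannZeta (1 + (2 * n + 1 : ℕ)) + deriv riemannZeta (1 + (2 * n + 1 : ℕ))) := by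
  have hpi : (2 * Real.pi : ℂ) ≠ 0 := by exact_mod_cast Real.two_pi_pos.ne'
  set s₀ : ℂ := 1 + (2 * n + 1 : ℕ) with hs₀
  have hre : s₀.re = 2 * n + 2 := by
    rw [hs₀, add_re, one_re, natCast_re]
    push_cast
    ring
  have hre' : 1 < s₀.re := by rw [hre]; linarith [Nat.cast_nonneg (α := ℝ) n]
  have hne : s₀ ≠ 1 := by
    intro h
    rw [h, one_re] at hre'
    exact lt_irrefl _ hre'
  have hcpow : (2 * Real.pi : ℂ) ^ (-s₀) = ((2 * Real.pi : ℂ) ^ (2 * n + 2))⁻¹ := by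
    rw [cpow_neg, hs₀, ← cpow_natCast]
    congr 2
    push_cast
    ring
  have hangle : (Real.pi : ℂ) * s₀ / 2 = (n + 1 : ℕ) * Real.pi := by
    rw [hs₀]
    push_cast
    ring
  have hcos : cos ((Real.pi : ℂ) * s₀ / 2) = (-1) ^ (n + 1) := by
    rw [hangle]
    exact_mod_cast congrArg ((↑) : ℝ → ℂ) (Real.cos_nat_mul_pi (n + 1))
  -- The derivative of the cosine factor therefore contributes nothing.
  have hsin : sin ((Real.pi : ℂ) * s₀ / 2) = 0 := by
    rw [hangle]
    exact Complex.sin_nat_mul_pi (n + 1)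
  have hGamma : Gamma s₀ = (2 * n + 1).factorial := by
    rw [hs₀, add_comm, Complex.Gamma_nat_eq_factorial]
  -- Source of both H_{2n+1} and γ.
  have dGamma := Complex.hasDerivAt_Gamma_nat (2 * n + 1)
  rw [add_comm ((2 * n + 1 : ℕ) : ℂ) 1, ← hs₀] at dGamma
  have dpow : HasDerivAt (fun s : ℂ ↦ (2 * Real.pi : ℂ) ^ (-s))
      ((2 * Real.pi : ℂ) ^ (-s₀) * log (2 * Real.pi) * -1) s₀ :=
    (hasDerivAt_neg' s₀).const_cpow (Or.inl hpi)
  have dcos : HasDerivAt (fun s : ℂ ↦ cos (Real.pi * s / 2))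
      (-sin (Real.pi * s₀ / 2) * (Real.pi * 1 / 2)) s₀ :=
    (((hasDerivAt_id s₀).const_mul (Real.pi : ℂ)).div_const 2).ccos
  have dzeta := (differentiableAt_riemannZeta hne).hasDerivAt
  have dR := (((dpow.const_mul 2).mul dGamma).mul dcos).mul dzeta
  have hne' : 1 - s₀ ≠ 1 := by
    intro h
    have : s₀ = 0 := by linear_combination -h
    rw [this, zero_re] at hre'
    linarith
  have dL : HasDerivAt (fun s : ℂ ↦ riemannZeta (1 - s)) (deriv riemannZeta (1 - s₀) * (-1)) s₀ :=
    (differentiableAt_riemannZeta hne').hasDerivAt.comp s₀ ((hasDerivAt_id s₀).const_sub 1)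
  have heq : (fun s : ℂ ↦ riemannZeta (1 - s)) =ᶠ[𝓝 s₀] fun s ↦
      2 * (2 * Real.pi : ℂ) ^ (-s) * Gamma s * cos (Real.pi * s / 2) * riemannZeta s := by
    filter_upwards [(isOpen_lt continuous_const continuous_re).mem_nhds hre'] with s hs
    refine riemannZeta_one_sub (fun k h ↦ ?_) fun h ↦ ?_
    · simp only [h, neg_re, natCast_re] at hs
      linarith [Nat.cast_nonneg (α := ℝ) k]
    · simp [h] at hs
  have key := dL.unique (dR.congr_of_eventuallyEq heq)
  simp only [Pi.mul_apply] at key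
  rw [hcos, hsin, hGamma, hcpow, show 1 - s₀ = -2 * (n : ℂ) - 1 by rw [hs₀]; push_cast; ring] at key
  have hlog : log (2 * Real.pi : ℂ) = (Real.log (2 * Real.pi) : ℝ) := by
    rw [ofReal_log Real.two_pi_pos.le]
    push_cast
    rfl
  rw [hlog] at key
  rw [div_eq_mul_inv]
  linear_combination -key

/-! ### Continuation to s = 1 and termwise differentiation -/

lemma mem_ball_one_half {s : ℂ} (hs : s ∈ Metric.ball (1 : ℂ) (1 / 2)) :
    ‖s‖ ≤ 2 ∧ 1 / 2 ≤ s.re := by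
  rw [mem_ball_iff_norm] at hs
  have h1 : ‖s‖ ≤ ‖s - 1‖ + ‖(1 : ℂ)‖ := norm_le_norm_sub_add s 1
  have h2 := (abs_le.1 ((abs_re_le_norm (s - 1)).trans hs.le)).1
  rw [norm_one] at h1
  rw [sub_re, one_re] at h2
  constructor <;> linarith

/-- The `m`-th term of the expansion of `ζ(s, 1 - x) - ζ(s, 1 + x)` in odd powers of `x`. -/
noncomputable def oddZetaTerm (x : ℝ) (m : ℕ) (s : ℂ) : ℂ :=
  2 * risingCoeff s (2 * m + 1) * (x : ℂ) ^ (2 * m + 1) * riemannZeta (s + (2 * m + 1 : ℕ))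

lemma add_odd_re_ge {s : ℂ} (hs : 1 / 2 ≤ s.re) (m : ℕ) :
    3 / 2 ≤ (s + (2 * m + 1 : ℕ)).re := by
  have : (0 : ℝ) ≤ m := m.cast_nonneg
  rw [add_re, natCast_re]
  push_cast
  linarith

lemma hasDerivAt_riemannZeta_add_odd {s : ℂ} (hs : 1 / 2 ≤ s.re) (m : ℕ) :
    HasDerivAt (fun s ↦ riemannZeta (s + (2 * m + 1 : ℕ)))
      (deriv riemannZeta (s + (2 * m + 1 : ℕ))) s := by
  have hne : s + (2 * m + 1 : ℕ) ≠ 1 := by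
    intro h
    have := add_odd_re_ge hs m
    rw [h, one_re] at this
    linarith
  exact (differentiableAt_riemannZeta hne).hasDerivAt.comp_add_const s _

lemma differentiableOn_oddZetaTerm (x : ℝ) (m : ℕ) :
    DifferentiableOn ℂ (oddZetaTerm x m) (Metric.ball 1 (1 / 2)) := fun s hs ↦
  (((((differentiable_risingCoeff (2 * m + 1)) s).const_mul 2).mul_const _).mul
    (hasDerivAt_riemannZeta_add_odd (mem_ball_one_half hs).2 m).differentiableAt)
    |>.differentiableWithinAt

lemma deriv_oddZetaTerm_one (x : ℝ) (m : ℕ) :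
    deriv (oddZetaTerm x m) 1 = 2 * (x : ℂ) ^ (2 * m + 1) *
      (harmonic (2 * m + 1) * riemannZeta (1 + (2 * m + 1 : ℕ))
        + deriv riemannZeta (1 + (2 * m + 1 : ℕ))) := by
  have h := ((((hasDerivAt_risingCoeff_one (2 * m + 1)).const_mul 2).mul_const
    ((x : ℂ) ^ (2 * m + 1))).mul (hasDerivAt_riemannZeta_add_odd (s := 1) (by norm_num) m)).deriv
  rw [risingCoeff_one] at h
  refine Eq.trans ?_ (h.trans (by ring))
  rfl

lemma norm_oddZetaTerm_le {x : ℝ} (hx0 : 0 < x) (m : ℕ) {s : ℂ}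
    (hs : s ∈ Metric.ball (1 : ℂ) (1 / 2)) :
    ‖oddZetaTerm x m s‖ ≤ 2 * (((2 * m + 1 : ℕ) : ℝ) + 1) * x ^ (2 * m + 1)
      * ∑' n : ℕ, 1 / ((n : ℝ) + 1) ^ (3 / 2 : ℝ) := by
  rw [oddZetaTerm, norm_mul]
  gcongr
  · exact norm_odd_coeff_le hx0 (mem_ball_one_half hs).1 m
  · exact norm_riemannZeta_le (add_odd_re_ge (mem_ball_one_half hs).2 m)

lemma differentiableOn_tsum_oddZetaTerm {x : ℝ} (hx0 : 0 < x) (hx1 : x < 1) :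
    DifferentiableOn ℂ (fun s ↦ ∑' m, oddZetaTerm x m s) (Metric.ball 1 (1 / 2)) :=
  differentiableOn_tsum_of_summable_norm ((summable_odd_bound hx0 hx1).mul_right _)
    (differentiableOn_oddZetaTerm x) Metric.isOpen_ball
    fun m _ hs ↦ norm_oddZetaTerm_le hx0 m hs

lemma hasDerivAt_one_div_cpow_one {x : ℝ} (hx0 : 0 < x) :
    HasDerivAt (fun s : ℂ ↦ 1 / (x : ℂ) ^ s) (-(Real.log x / x)) 1 := by
  have h : HasDerivAt (fun s : ℂ ↦ (x : ℂ) ^ (-s)) ((x : ℂ) ^ (-1 : ℂ) * log x * -1) 1 :=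
    (hasDerivAt_neg' (1 : ℂ)).const_cpow (Or.inl (ofReal_ne_zero.2 hx0.ne'))
  simp only [cpow_neg, cpow_one] at h
  simp only [one_div]
  refine h.congr_deriv ?_
  rw [ofReal_log hx0.le]
  ring

lemma hurwitzRegularPart_one_sub_sub_eqOn {x : ℝ} (hx0 : 0 < x) (hx1 : x < 1) :
    Set.EqOn (fun s ↦ hurwitzRegularPart (1 - x) s - hurwitzRegularPart x s)
      (fun s ↦ ∑' m, oddZetaTerm x m s - 1 / (x : ℂ) ^ s) (Metric.ball 1 (1 / 2)) := by
  have hx : (x : ℂ) ≠ 0 := ofReal_ne_zero.2 hx0.ne'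
  have hd : Differentiable ℂ (fun s : ℂ ↦ 1 / (x : ℂ) ^ s) := fun s ↦
    (differentiableAt_const _).div (differentiableAt_id.const_cpow (Or.inl hx))
      (by simp [cpow_eq_zero_iff, hx])
  -- A point of the ball with real part above 1, near which the Dirichlet series already give the
  -- identity.
  have hball : (5 / 4 : ℂ) ∈ Metric.ball (1 : ℂ) (1 / 2) := by
    rw [mem_ball_iff_norm]
    norm_num
  refine AnalyticOnNhd.eqOn_of_preconnected_of_eventuallyEq
    (((differentiable_hurwitzRegularPart _).sub
      (differentiable_hurwitzRegularPart _)).differentiableOn.analyticOnNhd Metric.isOpen_ball)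
    (((differentiableOn_tsum_oddZetaTerm hx0 hx1).sub
      hd.differentiableOn).analyticOnNhd Metric.isOpen_ball)
    (convex_ball _ _).isPreconnected hball ?_
  filter_upwards [Metric.isOpen_ball.mem_nhds hball,
    (isOpen_lt continuous_const continuous_re).mem_nhds
      (show (1 : ℝ) < (5 / 4 : ℂ).re by norm_num)] with s hs hre
  have hre' : 1 < s.re := hre
  have hne : s ≠ 1 := by
    rintro rfl
    simp at hre'
  have h := hurwitzZeta_one_sub_sub hx0 hx1 (mem_ball_one_half hs).1 hre'
  simp only [hurwitzRegularPart, Function.update_of_ne hne, oddZetaTerm]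
  rw [← h]
  ring

lemma stieltjesConst_one_one_sub_sub {x : ℝ} (hx0 : 0 < x) (hx1 : x < 1) :
    stieltjesConst 1 (1 - x) - stieltjesConst 1 x
      = -(deriv (fun s ↦ ∑' m, oddZetaTerm x m s) 1 + Real.log x / x) := by
  have hnhds : Metric.ball (1 : ℂ) (1 / 2) ∈ 𝓝 1 := Metric.ball_mem_nhds _ (by norm_num)
  have h1 := ((differentiable_hurwitzRegularPart (1 - x)) 1).hasDerivAt.sub
    ((differentiable_hurwitzRegularPart x) 1).hasDerivAt
  have h2 := ((differentiableOn_tsum_oddZetaTerm hx0 hx1).differentiableAt hnhds).hasDerivAt.sub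
    (hasDerivAt_one_div_cpow_one hx0)
  have h3 := h1.unique (h2.congr_of_eventuallyEq
    (Filter.eventuallyEq_of_mem hnhds (hurwitzRegularPart_one_sub_sub_eqOn hx0 hx1)))
  simp only [stieltjesConst, iteratedDeriv_one]
  linear_combination -h3

/-! ### Assembly -/

lemma two_pi_mul_zeta_deriv_term (x : ℝ) (n : ℕ) :
    2 * (Real.pi : ℂ) * ((-1 : ℂ) ^ (n + 1) * deriv riemannZeta (-2 * (n : ℂ) - 1)
      / ((2 * n + 1).factorial : ℂ) * (2 * (Real.pi : ℂ) * (x : ℂ)) ^ (2 * n + 1))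
      = (Real.eulerMascheroniConstant + Real.log (2 * Real.pi))
          * (2 * (x : ℂ) ^ (2 * n + 1) * riemannZeta (1 + (2 * n + 1 : ℕ)))
        - deriv (oddZetaTerm x n) 1 := by
  have hpi : (Real.pi : ℂ) ≠ 0 := ofReal_ne_zero.2 Real.pi_ne_zero
  have hf : ((2 * n + 1).factorial : ℂ) ≠ 0 := Nat.cast_ne_zero.2 (Nat.factorial_ne_zero _)
  have hsq : ((-1 : ℂ) ^ n) * (-1) ^ n = 1 := by rw [← mul_pow]; simp
  rw [deriv_riemannZeta_one_sub_two_mul, deriv_oddZetaTerm_one, mul_pow _ (x : ℂ),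
    pow_succ (2 * (Real.pi : ℂ)) (2 * n + 1), pow_succ (-1 : ℂ)]
  generalize riemannZeta (1 + (2 * n + 1 : ℕ)) = a
  generalize deriv riemannZeta (1 + (2 * n + 1 : ℕ)) = b
  generalize ((-1 : ℂ) ^ n) = e at *
  field_simp
  linear_combination (-(x : ℂ) ^ (2 * n + 1) * ((harmonic (2 * n + 1)
    - Real.eulerMascheroniConstant - Real.log (2 * Real.pi)) * a + b)) * hsq

theorem mainTheorem2 (x : ℝ) (hx0 : 0 < x) (hx1 : x < 1) :
    Summable (fun n : ℕ ↦ (-1 : ℂ) ^ (n + 1) * deriv riemannZeta (-2 * (n : ℂ) - 1)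
      / ((2 * n + 1).factorial : ℂ) * (2 * (Real.pi : ℂ) * (x : ℂ)) ^ (2 * n + 1)) ∧
    stieltjesConst 1 (1 - x) - stieltjesConst 1 x =
      ((-(Real.eulerMascheroniConstant + Real.log (2 * Real.pi * x)) / x
        + Real.pi * (Real.eulerMascheroniConstant + Real.log (2 * Real.pi))
          * Real.cot (Real.pi * x) : ℝ) : ℂ)
      + 2 * (Real.pi : ℂ) * ∑' n : ℕ, (-1 : ℂ) ^ (n + 1) * deriv riemannZeta (-2 * (n : ℂ) - 1)
        / ((2 * n + 1).factorial : ℂ) * (2 * (Real.pi : ℂ) * (x : ℂ)) ^ (2 * n + 1) := by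
  have hpi : (2 * Real.pi : ℂ) ≠ 0 := by exact_mod_cast Real.two_pi_pos.ne'
  have hderiv := hasSum_deriv_of_summable_norm ((summable_odd_bound hx0 hx1).mul_right _)
    (differentiableOn_oddZetaTerm x) Metric.isOpen_ball
    (fun m _ hs ↦ norm_oddZetaTerm_le hx0 m hs) (Metric.mem_ball_self (by norm_num))
  have h := (((hasSum_two_mul_zeta_even hx0 hx1).mul_left
    (Real.eulerMascheroniConstant + Real.log (2 * Real.pi) : ℂ)).sub hderiv).congr_fun
    (two_pi_mul_zeta_deriv_term x)
  refine ⟨(summable_mul_left_iff hpi).1 h.summable, ?_⟩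
  -- Splitting log(2πx) lets (γ + log 2π)/x from the cotangent sum cancel, leaving -log x / x.
  rw [← tsum_mul_left, h.tsum_eq, stieltjesConst_one_one_sub_sub hx0 hx1,
    Real.log_mul Real.two_pi_pos.ne' hx0.ne']
  push_cast
  ring
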